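/- Let $A\in\mathbb{C}^{n\times n}$ have singular values $s_1\ge s_2\ge\cdots\ge s_n$, let $b\in\mathbb{C}^n$, and suppose the Krylov subspace $\mathcal{K}_k(A,b)=\mathrm{span}\{b,Ab,\ldots,A^{k-1}b\}$ has dimension $k$. Let $\pi$ be a (degree-$k$) GMRES residual polynomial, that is, $\pi(z)=1-z\,p(z)$, where $p$ is a polynomial with $\deg p<k$ such that $\widehat{x}=p(A)b$ minimizes the Euclidean norm $\|b-Ax\|$ over $x\in\mathcal{K}_k(A,b)$. Let $\theta_1,\ldots,\theta_k\in\mathbb{C}\cup\{\infty\}$ be the roots of $\pi$ (the harmonic Ritz values), listed with multiplicity, where $\infty$ is counted $k-\deg\pi$ times, and ordered by increasing magnitude, $|\theta_1|\le|\theta_2|\le\cdots\le|\theta_k|$ (with $|\infty|=\infty$). Then \[ |\theta_j|\ \ge\ \big(s_n s_{n-1}\cdots s_{n-j+1}\big)^{1/j},\qquad j=1,\ldots,k. \] In particular, if $A$ is invertible, then $s_n=1/\|A^{-1}\|$ (spectral norm) and no harmonic Ritz value lies strictly inside the disk $\{z\in\mathbb{C}:|z|<1/\|A^{-1}\|\}$.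 -/

import Mathlib

/-- The Krylov subspace `K_k(T, b) = span {b, T b, …, T^(k-1) b}`. -/
def krylovSubspace {E : Type*} [AddCommGroup E] [Module ℂ E]
    (T : E →ₗ[ℂ] E) (b : E) (k : ℕ) : Submodule ℂ E :=
  Submodule.span ℂ (Set.range fun i : Fin k => (T ^ (i : ℕ)) b)

/-- `x` is a step-`k` GMRES approximation to the solution of `T x = b` (zero starting vector):
it lies in the Krylov subspace and minimizes the residual norm `‖b - T x‖` over it. -/
def IsGMRESIterate {E : Type*} [NormedAddCommGroup E] [InnerProductSpace ℂ E]
    (T : E →ₗ[ℂ] E) (b : E) (k : ℕ) (x : E) : Prop :=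
  x ∈ krylovSubspace T b k ∧ ∀ y ∈ krylovSubspace T b k, ‖b - T x‖ ≤ ‖b - T y‖

/-- `q` is a GMRES residual polynomial for step `k`: `q(z) = 1 - z p(z)` with `deg p < k`, where
`p(T) b` is the step-`k` GMRES approximation (so that `q(T) b` is the GMRES residual). -/
def IsGMRESResidualPolynomial {E : Type*} [NormedAddCommGroup E] [InnerProductSpace ℂ E]
    (T : E →ₗ[ℂ] E) (b : E) (k : ℕ) (q : Polynomial ℂ) : Prop :=
  ∃ p : Polynomial ℂ, p.degree < (k : WithBot ℕ) ∧
    IsGMRESIterate T b k (Polynomial.aeval T p b) ∧ q = 1 - Polynomial.X * p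

/-- The roots in `ℂ ∪ {∞}`, with multiplicity, of `q` regarded as a polynomial of formal degree
`k`: the finite roots together with `k - deg q` copies of `∞`. -/
noncomputable def extendedRoots (q : Polynomial ℂ) (k : ℕ) : Multiset (OnePoint ℂ) :=
  q.roots.map (fun z => (z : OnePoint ℂ)) + Multiset.replicate (k - q.natDegree) OnePoint.infty

/-- The magnitude `|z|` of a point of `ℂ ∪ {∞}`, with `|∞| = ∞`. -/
noncomputable def magnitude (z : OnePoint ℂ) : ENNReal :=
  z.elim ⊤ fun w : ℂ => ENNReal.ofReal ‖w‖

/-- The singular values `s_1 ≥ s_2 ≥ ⋯ ≥ s_n` of a square matrix, with the index starting at `1`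
(Mathlib's start at `0`); only used for `1 ≤ i ≤ n`. -/
noncomputable def singularValue {n : ℕ} (A : Matrix (Fin n) (Fin n) ℂ) (i : ℕ) : ℝ :=
  (Matrix.toEuclideanLin A).singularValues (i - 1)

/-- The spectral norm (operator norm for the Euclidean norm) of a square matrix. -/
noncomputable def spectralNorm2 {n : ℕ} (A : Matrix (Fin n) (Fin n) ℂ) : ℝ :=
  ‖Matrix.toEuclideanCLM (n := Fin n) (𝕜 := ℂ) A‖

/-! Let `g` be the monic polynomial whose roots are `j` finite roots of `q`, write `q = g * h`, and
put `c = h(T) b`. The space `Y = {f(T) c : deg f < j}` has dimension `j`, and the GMRES residual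
`g(T) c = q(T) b` is orthogonal to `T Y`. Multiplication by `X` modulo `g` becomes an operator `R`
on `Y` with `R y = T y - t • g(T) c` for a scalar `t` depending on `y`, so `‖T y‖ ≤ ‖R y‖` by
Pythagoras. Courant–Fischer then bounds the `j` smallest singular values of `T` by those of `R`,
whose product is `‖det R‖ = ‖g(0)‖`, the product of the moduli of the chosen roots. Taking the `j`
smallest roots gives the claim. -/

/-! ### Min-max comparison of singular values -/

open Module in
theorem OrthonormalBasis.exists_submodule_finrank_eq_card {𝕜 ι E : Type*} [RCLike 𝕜] [Fintype ι]
    [NormedAddCommGroup E] [InnerProductSpace 𝕜 E] (v : OrthonormalBasis ι 𝕜 E) (S : Finset ι) :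
    ∃ W : Submodule 𝕜 E, finrank 𝕜 W = S.card ∧ ∀ x ∈ W, ∀ m ∉ S, v.repr x m = 0 := by
  classical
  refine ⟨Submodule.span 𝕜 (Set.range fun i : S => v i), ?_, fun x hx m hm => ?_⟩
  · have h : LinearIndependent 𝕜 fun i : S => v i :=
      v.orthonormal.linearIndependent.comp _ Subtype.val_injective
    rw [finrank_span_eq_card h, Fintype.card_coe]
  · induction hx using Submodule.span_induction with
    | mem x hx =>
      obtain ⟨i, rfl⟩ := hx
      have : m ≠ i := fun h => hm (h ▸ i.2)
      simp [this]
    | zero => simp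
    | add x y _ _ hx hy => simp [hx, hy]
    | smul a x _ hx => simp [hx]

theorem Submodule.exists_ne_zero_mem_inf_of_finrank_lt {K V : Type*} [Field K] [AddCommGroup V]
    [Module K V] [FiniteDimensional K V] (U W : Submodule K V)
    (h : Module.finrank K V < Module.finrank K U + Module.finrank K W) :
    ∃ x ∈ U, x ∈ W ∧ x ≠ 0 := by
  have h1 := Submodule.finrank_sup_add_finrank_inf_eq U W
  have h2 := Submodule.finrank_le (U ⊔ W)
  have h3 : U ⊓ W ≠ ⊥ := by
    intro h0
    rw [h0, finrank_bot] at h1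
    omega
  obtain ⟨x, hx, hx0⟩ := Submodule.exists_mem_ne_zero_of_ne_bot h3
  exact ⟨x, hx.1, hx.2, hx0⟩

namespace LinearMap

open Module

variable {𝕜 E F G H : Type*} [RCLike 𝕜]
  [NormedAddCommGroup E] [InnerProductSpace 𝕜 E] [FiniteDimensional 𝕜 E]
  [NormedAddCommGroup F] [InnerProductSpace 𝕜 F] [FiniteDimensional 𝕜 F]
  [NormedAddCommGroup G] [InnerProductSpace 𝕜 G] [FiniteDimensional 𝕜 G]
  [NormedAddCommGroup H] [InnerProductSpace 𝕜 H] [FiniteDimensional 𝕜 H]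

theorem norm_sq_apply_eq_sum_singularValues (T : E →ₗ[𝕜] F) (x : E) :
    ‖T x‖ ^ 2 = ∑ i : Fin (finrank 𝕜 E), T.singularValues i ^ 2 *
      ‖(T.isSymmetric_adjoint_comp_self.eigenvectorBasis rfl).repr x i‖ ^ 2 := by
  have h1 : ‖T x‖ ^ 2 = RCLike.re (inner 𝕜 x ((adjoint T ∘ₗ T) x)) := by
    rw [comp_apply, adjoint_inner_right, inner_self_eq_norm_sq]
  rw [h1, ← (T.isSymmetric_adjoint_comp_self.eigenvectorBasis rfl).repr.inner_map_map,
    PiLp.inner_apply, map_sum]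
  refine Finset.sum_congr rfl fun i _ => ?_
  rw [IsSymmetric.eigenvectorBasis_apply_self_apply, T.sq_singularValues_fin rfl,
    RCLike.inner_apply, mul_assoc, RCLike.mul_conj, ← RCLike.ofReal_pow, ← RCLike.ofReal_mul,
    RCLike.ofReal_re]

/-- `W` is spanned by the leading eigenvectors of `T* T`; the next lemma uses the trailing ones. -/
theorem exists_submodule_singularValues_mul_norm_le (T : E →ₗ[𝕜] F) {i : ℕ}
    (hi : i < finrank 𝕜 E) :
    ∃ W : Submodule 𝕜 E, finrank 𝕜 W = i + 1 ∧
      ∀ x ∈ W, T.singularValues i * ‖x‖ ≤ ‖T x‖ := by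
  set v := T.isSymmetric_adjoint_comp_self.eigenvectorBasis rfl with hv
  obtain ⟨W, hW, h⟩ := v.exists_submodule_finrank_eq_card (Finset.Iic ⟨i, hi⟩)
  refine ⟨W, by simpa using hW, fun x hx => ?_⟩
  have h0 := T.singularValues_nonneg i
  refine (sq_le_sq₀ (by positivity) (by positivity)).mp ?_
  rw [mul_pow, T.norm_sq_apply_eq_sum_singularValues, ← hv, ← v.repr.norm_map x,
    EuclideanSpace.norm_sq_eq, Finset.mul_sum]
  refine Finset.sum_le_sum fun m _ => ?_
  by_cases hm : m ∈ Finset.Iic (⟨i, hi⟩ : Fin (finrank 𝕜 E))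
  · have := T.singularValues_antitone (Fin.le_def.mp (Finset.mem_Iic.mp hm))
    gcongr
  · simp [h x hx m hm]

theorem exists_submodule_norm_le_singularValues_mul (T : E →ₗ[𝕜] F) {i : ℕ}
    (hi : i < finrank 𝕜 E) :
    ∃ W : Submodule 𝕜 E, finrank 𝕜 W = finrank 𝕜 E - i ∧
      ∀ x ∈ W, ‖T x‖ ≤ T.singularValues i * ‖x‖ := by
  set v := T.isSymmetric_adjoint_comp_self.eigenvectorBasis rfl with hv
  obtain ⟨W, hW, h⟩ := v.exists_submodule_finrank_eq_card (Finset.Ici ⟨i, hi⟩)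
  refine ⟨W, by simpa using hW, fun x hx => ?_⟩
  have h0 := T.singularValues_nonneg i
  refine (sq_le_sq₀ (by positivity) (by positivity)).mp ?_
  rw [mul_pow, T.norm_sq_apply_eq_sum_singularValues, ← hv, ← v.repr.norm_map x,
    EuclideanSpace.norm_sq_eq, Finset.mul_sum]
  refine Finset.sum_le_sum fun m _ => ?_
  by_cases hm : m ∈ Finset.Ici (⟨i, hi⟩ : Fin (finrank 𝕜 E))
  · have := T.singularValues_antitone (Fin.le_def.mp (Finset.mem_Ici.mp hm))
    have h1 := T.singularValues_nonneg m
    gcongr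
  · simp [h x hx m hm]

/-- A leading space of `T`, of dimension `i + d + 1`, must meet the image of a trailing space of
`S`, of dimension `finrank G - i`: the dimensions sum to `finrank E + 1`. -/
theorem singularValues_add_le_of_norm_le (T : E →ₗ[𝕜] F) (S : G →ₗ[𝕜] H) (ι : G →ₗᵢ[𝕜] E)
    (h : ∀ x, ‖T (ι x)‖ ≤ ‖S x‖) {d : ℕ} (hd : finrank 𝕜 G + d = finrank 𝕜 E) {i : ℕ}
    (hi : i < finrank 𝕜 G) :
    T.singularValues (i + d) ≤ S.singularValues i := by
  obtain ⟨U, hU, hUT⟩ :=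
    T.exists_submodule_singularValues_mul_norm_le (i := i + d) (by omega)
  obtain ⟨W, hW, hWS⟩ := S.exists_submodule_norm_le_singularValues_mul hi
  have hWι : finrank 𝕜 (W.map ι.toLinearMap) = finrank 𝕜 W :=
    (Submodule.equivMapOfInjective _ ι.injective W).finrank_eq.symm
  obtain ⟨x, hxU, ⟨w, hw, rfl⟩, hx0⟩ :=
    Submodule.exists_ne_zero_mem_inf_of_finrank_lt U (W.map ι.toLinearMap) (by omega)
  have h1 := ((hUT _ hxU).trans (h w)).trans (hWS w hw)
  have h2 : 0 < ‖w‖ := by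
    rw [norm_pos_iff]
    rintro rfl
    simp at hx0
  simp only [LinearIsometry.coe_toLinearMap, LinearIsometry.norm_map] at h1
  exact le_of_mul_le_mul_right h1 h2

end LinearMap

/-! ### Multiplication modulo `g` and its determinant -/

namespace LinearMap

open Module Polynomial

variable {E : Type*} [NormedAddCommGroup E] [InnerProductSpace ℂ E] [FiniteDimensional ℂ E]

theorem prod_singularValues_le_norm_det_of_norm_le (T : E →ₗ[ℂ] E) (Y : Submodule ℂ E)
    (R : Y →ₗ[ℂ] Y) (h : ∀ y : Y, ‖T y‖ ≤ ‖R y‖) :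
    ∏ i ∈ Finset.range (finrank ℂ Y), T.singularValues (i + (finrank ℂ E - finrank ℂ Y)) ≤
      ‖R.det‖ := by
  rw [← normDet_eq_norm_det, normDet_eq_prod_singularValues]
  have hY := Y.finrank_le
  refine Finset.prod_le_prod (fun i _ => T.singularValues_nonneg _) fun i hi => ?_
  exact singularValues_add_le_of_norm_le T R Y.subtypeₗᵢ h (by omega) (Finset.mem_range.mp hi)

theorem _root_.AdjoinRoot.norm_det_mulLeft_root {K : Type*} [NormedField K] {g : K[X]}
    (hg : g.Monic) : ‖(LinearMap.mulLeft K (AdjoinRoot.root g)).det‖ = ‖g.coeff 0‖ := by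
  have h := Algebra.PowerBasis.norm_gen_eq_coeff_zero_minpoly (AdjoinRoot.powerBasis hg.ne_zero)
  rw [AdjoinRoot.minpoly_powerBasis_gen_of_monic hg, AdjoinRoot.powerBasis_gen,
    Algebra.norm_apply] at h
  change LinearMap.det (LinearMap.mulLeft K (AdjoinRoot.root g)) = _ at h
  rw [h]
  simp

/-- By `hinj`, evaluation at `c` identifies `AdjoinRoot g` with a subspace of `E`; `horth` makes
multiplication by the root dominate `T` there. -/
theorem prod_singularValues_le_norm_coeff_zero (T : E →ₗ[ℂ] E) (c : E) {g : ℂ[X]} (hg : g.Monic)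
    (hinj : ∀ f : ℂ[X], f.degree < g.degree → aeval T f c = 0 → f = 0)
    (horth : ∀ f : ℂ[X], f.degree < g.degree →
      inner ℂ (T (aeval T f c)) (aeval T g c) = 0) :
    ∏ i ∈ Finset.range g.natDegree, T.singularValues (i + (finrank ℂ E - g.natDegree)) ≤
      ‖g.coeff 0‖ := by
  let φ : AdjoinRoot g →ₗ[ℂ] E :=
    applyₗ c ∘ₗ (aeval T).toLinearMap ∘ₗ AdjoinRoot.modByMonicHom hg
  have hφ : ∀ f : ℂ[X], φ (AdjoinRoot.mk g f) = aeval T (f %ₘ g) c := fun f => rfl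
  have hφinj : Function.Injective φ := by
    rw [injective_iff_map_eq_zero]
    intro a ha
    obtain ⟨f, rfl⟩ := AdjoinRoot.mk_surjective a
    rw [hφ] at ha
    have := hinj _ (degree_modByMonic_lt f hg) ha
    rw [AdjoinRoot.mk_eq_zero]
    exact (modByMonic_eq_zero_iff_dvd hg).mp this
  let e : AdjoinRoot g ≃ₗ[ℂ] φ.range := LinearEquiv.ofInjective φ hφinj
  have hdim : finrank ℂ φ.range = g.natDegree := by
    rw [← e.finrank_eq, (AdjoinRoot.powerBasis hg.ne_zero).finrank, AdjoinRoot.powerBasis_dim]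
  rw [← AdjoinRoot.norm_det_mulLeft_root hg, ← LinearMap.det_conj _ e, ← hdim]
  refine prod_singularValues_le_norm_det_of_norm_le T _ _ fun y => ?_
  obtain ⟨a, rfl⟩ := e.surjective y
  obtain ⟨f, rfl⟩ := AdjoinRoot.mk_surjective a
  have hRy : ((e.toLinearMap ∘ₗ mulLeft ℂ (AdjoinRoot.root g) ∘ₗ e.symm.toLinearMap)
      (e (AdjoinRoot.mk g f)) : E) = aeval T ((X * (f %ₘ g)) %ₘ g) c := by
    simp only [comp_apply, LinearEquiv.coe_coe, LinearEquiv.symm_apply_apply, mulLeft_apply]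
    change φ _ = _
    rw [← hφ]
    congr 1
    rw [map_mul, AdjoinRoot.mk_X, ← AdjoinRoot.modByMonicHom_mk hg, AdjoinRoot.mk_leftInverse]
  rw [← Submodule.norm_coe, hRy]
  change ‖T (φ _)‖ ≤ _
  rw [hφ]
  set p := f %ₘ g with hp
  have hpdeg : p.degree < g.degree := degree_modByMonic_lt f hg
  -- `X * p` has degree at most that of `g`, so reduction subtracts only a scalar multiple of `g`.
  obtain ⟨t, ht⟩ : ∃ t, (X * p) /ₘ g = C t := by
    refine ⟨_, eq_C_of_degree_le_zero ?_⟩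
    rw [← natDegree_eq_zero_iff_degree_le_zero, natDegree_divByMonic _ hg]
    have := natDegree_mul_le (p := X) (q := p)
    have h2 : p.natDegree ≤ g.natDegree := natDegree_le_natDegree hpdeg.le
    by_cases hp0 : p = 0
    · simp [hp0]
    · have h3 := (natDegree_lt_natDegree_iff hp0).mpr hpdeg
      rw [natDegree_X] at this
      omega
  have hdecomp : aeval T ((X * p) %ₘ g) c = T (aeval T p c) - t • aeval T g c := by
    rw [modByMonic_eq_sub_mul_div, ht]
    simp [mul_comm g]
  -- Pythagoras: the cross term vanishes by `horth`.
  rw [hdecomp, ← sq_le_sq₀ (norm_nonneg _) (norm_nonneg _), norm_sub_sq (𝕜 := ℂ),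
    inner_smul_right, horth p hpdeg]
  simp

end LinearMap

/-! ### Krylov subspaces and GMRES residuals -/

section Krylov

open Module Polynomial

variable {E : Type*} [AddCommGroup E] [Module ℂ E]

theorem Polynomial.aeval_apply_eq_sum_fin (T : E →ₗ[ℂ] E) (b : E) {k : ℕ} {f : ℂ[X]}
    (hf : f.degree < k) : aeval T f b = ∑ i : Fin k, f.coeff i • (T ^ (i : ℕ)) b := by
  rcases eq_or_ne f 0 with rfl | h0
  · simp
  · rw [aeval_eq_sum_range' ((natDegree_lt_iff_degree_lt h0).mpr hf), LinearMap.sum_apply,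
      Finset.sum_range]
    rfl

theorem aeval_apply_mem_krylovSubspace (T : E →ₗ[ℂ] E) (b : E) {k : ℕ} {f : ℂ[X]}
    (hf : f.degree < k) : aeval T f b ∈ krylovSubspace T b k := by
  rw [aeval_apply_eq_sum_fin T b hf]
  exact Submodule.sum_mem _ fun i _ =>
    Submodule.smul_mem _ _ (Submodule.subset_span (Set.mem_range_self i))

theorem eq_zero_of_aeval_apply_eq_zero {T : E →ₗ[ℂ] E} {b : E} {k : ℕ}
    (hdim : finrank ℂ (krylovSubspace T b k) = k) {f : ℂ[X]} (hf : f.degree < k)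
    (h : aeval T f b = 0) : f = 0 := by
  have hli : LinearIndependent ℂ fun i : Fin k => (T ^ (i : ℕ)) b := by
    rw [linearIndependent_iff_card_eq_finrank_span, Fintype.card_fin]
    exact hdim.symm
  rw [aeval_apply_eq_sum_fin T b hf] at h
  have hc := Fintype.linearIndependent_iff.mp hli _ h
  ext i
  rcases lt_or_ge i k with hi | hi
  · exact hc ⟨i, hi⟩
  · exact coeff_eq_zero_of_degree_lt (hf.trans_le (by exact_mod_cast hi))

end Krylov

section GMRES

open Module Polynomial

variable {E : Type*} [NormedAddCommGroup E] [InnerProductSpace ℂ E] {T : E →ₗ[ℂ] E} {b : E}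
  {k : ℕ} {q : ℂ[X]}

/-- `T x` is the best approximation to `b` from the image of the Krylov subspace under `T`. -/
theorem IsGMRESIterate.inner_eq_zero {x y : E} (h : IsGMRESIterate T b k x)
    (hy : y ∈ krylovSubspace T b k) : inner ℂ (T y) (b - T x) = 0 := by
  have hx : T x ∈ (krylovSubspace T b k).map T := Submodule.mem_map_of_mem h.1
  rw [inner_eq_zero_symm]
  refine (Submodule.norm_eq_iInf_iff_inner_eq_zero _ hx).mp ?_ _ (Submodule.mem_map_of_mem hy)
  refine le_antisymm (le_ciInf ?_) (ciInf_le (f := fun w : (krylovSubspace T b k).map T =>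
    ‖b - w‖) ⟨0, ?_⟩ ⟨T x, hx⟩)
  · rintro ⟨_, z, hz, rfl⟩
    exact h.2 z hz
  · rintro _ ⟨w, rfl⟩
    exact norm_nonneg _

theorem IsGMRESResidualPolynomial.coeff_zero (hq : IsGMRESResidualPolynomial T b k q) :
    q.coeff 0 = 1 := by
  obtain ⟨p, -, -, rfl⟩ := hq
  simp

theorem IsGMRESResidualPolynomial.ne_zero (hq : IsGMRESResidualPolynomial T b k q) : q ≠ 0 := by
  rintro rfl
  simpa using hq.coeff_zero

theorem IsGMRESResidualPolynomial.degree_le (hq : IsGMRESResidualPolynomial T b k q) :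
    q.degree ≤ k := by
  obtain ⟨p, hp, -, rfl⟩ := hq
  rcases eq_or_ne p 0 with rfl | h0
  · simp
  · have := (natDegree_lt_iff_degree_lt h0).mpr hp
    rw [← natDegree_le_iff_degree_le]
    refine (natDegree_sub_le _ _).trans ?_
    rw [natDegree_one, natDegree_X_mul h0]
    omega

theorem IsGMRESResidualPolynomial.inner_eq_zero (hq : IsGMRESResidualPolynomial T b k q) {y : E}
    (hy : y ∈ krylovSubspace T b k) : inner ℂ (T y) (aeval T q b) = 0 := by
  obtain ⟨p, -, hp, rfl⟩ := hq
  simpa using hp.inner_eq_zero hy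

theorem IsGMRESResidualPolynomial.prod_singularValues_le_norm_coeff_zero [FiniteDimensional ℂ E]
    (hq : IsGMRESResidualPolynomial T b k q) (hdim : finrank ℂ (krylovSubspace T b k) = k)
    {g : ℂ[X]} (hg : g.Monic) (hgq : g ∣ q) :
    ∏ i ∈ Finset.range g.natDegree, T.singularValues (i + (finrank ℂ E - g.natDegree)) ≤
      ‖g.coeff 0‖ := by
  obtain ⟨h, rfl⟩ := hgq
  have hh : h ≠ 0 := right_ne_zero_of_mul hq.ne_zero
  have hdeg : ∀ f : ℂ[X], f.degree < g.degree → (f * h).degree < k := fun f hf => by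
    refine lt_of_lt_of_le ?_ hq.degree_le
    rw [degree_mul, degree_mul]
    exact WithBot.add_lt_add_right (degree_ne_bot.mpr hh) hf
  have haeval : ∀ f : ℂ[X], aeval T f (aeval T h b) = aeval T (f * h) b := fun f => by
    rw [map_mul]
    rfl
  -- Since `deg (f * h) < deg q ≤ k`, both hypotheses reduce to facts about `K_k(T, b)`.
  refine T.prod_singularValues_le_norm_coeff_zero (aeval T h b) hg (fun f hf hf0 => ?_)
    fun f hf => ?_
  · rw [haeval] at hf0
    exact (mul_eq_zero.mp (eq_zero_of_aeval_apply_eq_zero hdim (hdeg f hf) hf0)).resolve_right hh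
  · rw [haeval, haeval]
    exact hq.inner_eq_zero (aeval_apply_mem_krylovSubspace T b (hdeg f hf))

theorem IsGMRESResidualPolynomial.prod_singularValues_le_prod_norm_roots [FiniteDimensional ℂ E]
    (hq : IsGMRESResidualPolynomial T b k q) (hdim : finrank ℂ (krylovSubspace T b k) = k)
    {s : Multiset ℂ} (hs : s ≤ q.roots) :
    ∏ i ∈ Finset.range s.card, T.singularValues (i + (finrank ℂ E - s.card)) ≤
      ‖s.prod‖ := by
  have h := hq.prod_singularValues_le_norm_coeff_zero hdim
    (monic_multiset_prod_of_monic s (fun z => X - C z) fun z _ => monic_X_sub_C z)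
    ((Multiset.prod_X_sub_C_dvd_iff_le_roots hq.ne_zero s).mpr hs)
  rw [natDegree_multiset_prod_X_sub_C_eq_card, coeff_zero_multiset_prod, Multiset.map_map] at h
  simpa [Function.comp_def, Multiset.prod_map_neg] using h

end GMRES

/-! ### Roots at infinity, the smallest singular value, and the final bounds -/

theorem extendedRoots_eq (q : Polynomial ℂ) (k : ℕ) :
    extendedRoots q k = q.roots.map OnePoint.some +
      Multiset.replicate (k - q.natDegree) OnePoint.infty := by
  simp [extendedRoots, Multiset.bind_def, Multiset.pure_def, Multiset.bind_singleton]

theorem le_roots_of_map_some_le_extendedRoots {q : Polynomial ℂ} {k : ℕ} {s : Multiset ℂ}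
    (h : s.map OnePoint.some ≤ extendedRoots q k) : s ≤ q.roots := by
  classical
  rw [extendedRoots_eq, Multiset.le_iff_count] at h
  rw [Multiset.le_iff_count]
  intro z
  have hz := h z
  rwa [Multiset.count_add, Multiset.count_replicate, if_neg (OnePoint.infty_ne_coe z), add_zero,
    Multiset.count_map_eq_count' _ _ OnePoint.coe_injective,
    Multiset.count_map_eq_count' _ _ OnePoint.coe_injective] at hz

@[simp]
theorem magnitude_coe (z : ℂ) : magnitude z = ENNReal.ofReal ‖z‖ := rfl

@[simp]
theorem magnitude_infty : magnitude OnePoint.infty = ⊤ := rfl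

theorem exists_eq_coe_of_magnitude_ne_top {x : OnePoint ℂ} (h : magnitude x ≠ ⊤) :
    ∃ z : ℂ, x = z := by
  induction x using OnePoint.rec with
  | infty => simp at h
  | coe z => exact ⟨z, rfl⟩

theorem prod_Icc_singularValue {n j : ℕ} (A : Matrix (Fin n) (Fin n) ℂ) (hj : j ≤ n) :
    ∏ i ∈ Finset.Icc (n - j + 1) n, singularValue A i =
      ∏ i ∈ Finset.range j, (Matrix.toEuclideanLin A).singularValues (i + (n - j)) := by
  have h : Finset.Icc (n - j + 1) n = Finset.Ico (n - j + 1) (n + 1) := by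
    ext i
    simp
  rw [h, Finset.prod_Ico_eq_prod_range, show n + 1 - (n - j + 1) = j by omega]
  refine Finset.prod_congr rfl fun i _ => ?_
  rw [singularValue]
  congr 1
  omega

theorem toEuclideanLin_inv_apply_apply {n : ℕ} {A : Matrix (Fin n) (Fin n) ℂ} (hA : IsUnit A)
    (x : EuclideanSpace ℂ (Fin n)) :
    Matrix.toEuclideanLin A⁻¹ (Matrix.toEuclideanLin A x) = x := by
  have h : A⁻¹ * A = 1 := Matrix.nonsing_inv_mul A ((Matrix.isUnit_iff_isUnit_det A).mp hA)
  ext i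
  simp [Matrix.toLpLin_apply, h]

theorem norm_toEuclideanLin_le {n : ℕ} (A : Matrix (Fin n) (Fin n) ℂ)
    (x : EuclideanSpace ℂ (Fin n)) :
    ‖Matrix.toEuclideanLin A x‖ ≤ spectralNorm2 A * ‖x‖ :=
  (Matrix.toEuclideanCLM (n := Fin n) (𝕜 := ℂ) A).le_opNorm x

theorem spectralNorm2_le {n : ℕ} (A : Matrix (Fin n) (Fin n) ℂ) {c : ℝ} (hc : 0 ≤ c)
    (h : ∀ x, ‖Matrix.toEuclideanLin A x‖ ≤ c * ‖x‖) : spectralNorm2 A ≤ c :=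
  (Matrix.toEuclideanCLM (n := Fin n) (𝕜 := ℂ) A).opNorm_le_bound hc h

theorem singularValue_last_eq {n : ℕ} {A : Matrix (Fin n) (Fin n) ℂ} (hA : IsUnit A) :
    singularValue A n = 1 / spectralNorm2 A⁻¹ := by
  have hfr : Module.finrank ℂ (EuclideanSpace ℂ (Fin n)) = n := finrank_euclideanSpace_fin
  -- For `n = 0` both sides are `0`, using `1 / 0 = 0`.
  rcases Nat.eq_zero_or_pos n with rfl | hn
  · have h0 : spectralNorm2 A⁻¹ = 0 :=
      le_antisymm (spectralNorm2_le _ le_rfl fun x => by simp [Subsingleton.elim x 0])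
        (norm_nonneg _)
    rw [h0, div_zero, singularValue, LinearMap.singularValues_of_finrank_le _ (by omega)]
  set T := Matrix.toEuclideanLin A with hT
  have hinj : Function.Injective T :=
    Function.LeftInverse.injective (toEuclideanLin_inv_apply_apply hA)
  have hpos : 0 < singularValue A n :=
    T.injective_iff_forall_lt_finrank_singularValues_pos.mp hinj _ (by omega)
  -- At the last index `U` is the whole space, which bounds the inverse above, and `W` is a line on
  -- which that bound is attained.
  obtain ⟨U, hU, hUT⟩ := T.exists_submodule_singularValues_mul_norm_le (i := n - 1) (by omega)
  obtain ⟨W, hW, hWT⟩ := T.exists_submodule_norm_le_singularValues_mul (i := n - 1) (by omega)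
  have hUtop : U = ⊤ := Submodule.eq_top_of_finrank_eq (by omega)
  have hupper : spectralNorm2 A⁻¹ ≤ (singularValue A n)⁻¹ := by
    refine spectralNorm2_le _ (by positivity) fun y => ?_
    obtain ⟨x, rfl⟩ := (LinearMap.injective_iff_surjective.mp hinj) y
    rw [toEuclideanLin_inv_apply_apply hA, inv_mul_eq_div, le_div_iff₀' hpos]
    exact hUT x (hUtop ▸ Submodule.mem_top)
  obtain ⟨w, hw, hw0⟩ := Submodule.exists_mem_ne_zero_of_ne_bot
    (p := W) (by rintro rfl; rw [finrank_bot] at hW; omega)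
  have hwpos : 0 < ‖w‖ := norm_pos_iff.mpr hw0
  have hlower : 1 ≤ spectralNorm2 A⁻¹ * singularValue A n := by
    have h1 := norm_toEuclideanLin_le A⁻¹ (T w)
    rw [toEuclideanLin_inv_apply_apply hA] at h1
    have h2 : spectralNorm2 A⁻¹ * ‖T w‖ ≤ spectralNorm2 A⁻¹ * (singularValue A n * ‖w‖) :=
      mul_le_mul_of_nonneg_left (hWT w hw) (norm_nonneg _)
    refine le_of_mul_le_mul_right ?_ hwpos
    linarith
  have heq : spectralNorm2 A⁻¹ * singularValue A n = 1 :=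
    le_antisymm ((le_inv_mul_iff₀' hpos).mp (by simpa using hupper)) hlower
  rw [eq_div_iff (left_ne_zero_of_mul_eq_one heq), mul_comm, heq]

theorem prod_singularValue_rpow_le_magnitude {n k : ℕ} (A : Matrix (Fin n) (Fin n) ℂ)
    (b : EuclideanSpace ℂ (Fin n))
    (hdim : Module.finrank ℂ (krylovSubspace (Matrix.toEuclideanLin A) b k) = k)
    {q : Polynomial ℂ}
    (hq : IsGMRESResidualPolynomial (Matrix.toEuclideanLin A) b k q)
    {θ : Fin k → OnePoint ℂ}
    (hroots : Finset.univ.val.map θ = extendedRoots q k)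
    (hmono : Monotone fun i => magnitude (θ i)) {j : ℕ} (hj : 1 ≤ j) (hjk : j ≤ k)
    (hlt : j - 1 < k) :
    ENNReal.ofReal ((∏ i ∈ Finset.Icc (n - j + 1) n, singularValue A i) ^ (1 / (j : ℝ)))
      ≤ magnitude (θ ⟨j - 1, hlt⟩) := by
  have hfr : Module.finrank ℂ (EuclideanSpace ℂ (Fin n)) = n := finrank_euclideanSpace_fin
  have hkn : k ≤ n := by
    have := (krylovSubspace (Matrix.toEuclideanLin A) b k).finrank_le
    omega
  -- If the `j`-th root is finite, monotonicity makes all earlier ones finite too.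
  by_cases htop : magnitude (θ ⟨j - 1, hlt⟩) = ⊤
  · rw [htop]
    exact le_top
  have hle : ∀ i : Fin j, magnitude (θ (Fin.castLE hjk i)) ≤ magnitude (θ ⟨j - 1, hlt⟩) :=
    fun i => hmono (Fin.le_def.mpr (by simp; omega))
  choose z hz using fun i : Fin j =>
    exists_eq_coe_of_magnitude_ne_top (ne_top_of_le_ne_top htop (hle i))
  have hs : Finset.univ.val.map z ≤ q.roots := by
    refine le_roots_of_map_some_le_extendedRoots (k := k) ?_
    rw [← hroots, Multiset.map_map]
    have h1 : OnePoint.some ∘ z = θ ∘ Fin.castLE hjk := funext fun i => (hz i).symm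
    rw [h1, ← Multiset.map_map]
    exact Multiset.map_le_map
      (Finset.val_le_iff.mpr (Finset.subset_univ (Finset.univ.map (Fin.castLEEmb hjk))))
  have hprod := hq.prod_singularValues_le_prod_norm_roots hdim hs
  rw [Multiset.card_map, Finset.card_val, Finset.card_univ, Fintype.card_fin, hfr,
    ← prod_Icc_singularValue A (hjk.trans hkn), Finset.prod_map_val, norm_prod] at hprod
  set m : Fin j := ⟨j - 1, by omega⟩
  have hm : θ ⟨j - 1, hlt⟩ = z m := hz m
  have hnorm : ∀ i, ‖z i‖ ≤ ‖z m‖ := fun i => by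
    have := hle i
    rw [hz, hm, magnitude_coe, magnitude_coe] at this
    exact (ENNReal.ofReal_le_ofReal_iff (norm_nonneg _)).mp this
  rw [hm, magnitude_coe]
  refine ENNReal.ofReal_le_ofReal ?_
  have hnonneg : 0 ≤ ∏ i ∈ Finset.Icc (n - j + 1) n, singularValue A i :=
    Finset.prod_nonneg fun i _ => LinearMap.singularValues_nonneg _ _
  have hpow : ∏ i ∈ Finset.Icc (n - j + 1) n, singularValue A i ≤ ‖z m‖ ^ j :=
    hprod.trans ((Finset.prod_le_prod (fun i _ => norm_nonneg _) fun i _ => hnorm i).trans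
      (by simp))
  refine (Real.rpow_le_rpow hnonneg hpow (by positivity)).trans_eq ?_
  rw [one_div, Real.pow_rpow_inv_natCast (norm_nonneg _) (by omega)]

theorem theorem2p4 {n k : ℕ} (A : Matrix (Fin n) (Fin n) ℂ) (b : EuclideanSpace ℂ (Fin n))
    (hdim : Module.finrank ℂ (krylovSubspace (Matrix.toEuclideanLin A) b k) = k)
    (q : Polynomial ℂ)
    (hq : IsGMRESResidualPolynomial (Matrix.toEuclideanLin A) b k q)
    (θ : Fin k → OnePoint ℂ)
    (hroots : Finset.univ.val.map θ = extendedRoots q k)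
    (hmono : Monotone fun i => magnitude (θ i)) :
    (∀ (j : ℕ) (hj : 1 ≤ j) (hjk : j ≤ k),
      ENNReal.ofReal ((∏ i ∈ Finset.Icc (n - j + 1) n, singularValue A i) ^ (1 / (j : ℝ)))
        ≤ magnitude (θ ⟨j - 1, by omega⟩)) ∧
    (IsUnit A →
      singularValue A n = 1 / spectralNorm2 A⁻¹ ∧
      ∀ (i : Fin k) (z : ℂ), θ i = (z : OnePoint ℂ) →
        z ∉ Metric.ball (0 : ℂ) (1 / spectralNorm2 A⁻¹)) := by
  refine ⟨fun j hj hjk => prod_singularValue_rpow_le_magnitude A b hdim hq hroots hmono hj hjk _,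
    fun hA => ⟨singularValue_last_eq hA, fun i z hz => ?_⟩⟩
  have hk : 1 ≤ k := i.pos
  have hlt : 1 - 1 < k := by omega
  -- The case `j = 1` bounds the smallest root, hence every root by monotonicity.
  have h := prod_singularValue_rpow_le_magnitude A b hdim hq hroots hmono le_rfl hk hlt
  have hn : 1 ≤ n := by
    have := (krylovSubspace (Matrix.toEuclideanLin A) b k).finrank_le
    rw [finrank_euclideanSpace_fin] at this
    omega
  have hi := h.trans (hmono (Fin.le_def.mpr (Nat.zero_le i) : (⟨1 - 1, hlt⟩ : Fin k) ≤ i))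
  simp only [hz, magnitude_coe] at hi
  rw [ENNReal.ofReal_le_ofReal_iff (norm_nonneg _), Nat.sub_add_cancel hn, Finset.Icc_self,
    Finset.prod_singleton, Nat.cast_one, div_one, Real.rpow_one, singularValue_last_eq hA] at hi
  rw [mem_ball_zero_iff, not_lt]
  exact hi
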